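/- **Setting.** Let $\mathcal S,\mathcal A,\mathcal F$ be sets (states, actions, reward feedback), $s_1\in\mathcal S$, $H\in\mathbb N$; $\Delta(X)$ denotes the discrete probability distributions on a set $X$. Let $\Pi$ be a finite non-empty set of policies $\pi:\mathcal S\to\Delta(\mathcal A)$ (deterministic policies being a special case) and $\mathcal P$ a finite set of transition kernels $P:\mathcal S\times\mathcal A\to\Delta(\mathcal S)$. An episode of $\pi$ under $P$ is a trajectory $\tau=(s_1,a_1,\dots,s_H,a_H)$ with $a_h\sim\pi(\cdot|s_h)$, $s_{h+1}\sim P(\cdot|s_h,a_h)$. An element $R$ of the reward space $\mathcal R$ consists of a reward function $R:\mathcal S\times\mathcal A\to[0,1]$ and of the conditional law $R(\cdot|\tau)\in\Delta(\mathcal F)$ of the reward feedback given the trajectory; under bandit feedback, the feedback is the list of realized rewards, whose conditional means are $R(s_h,a_h)$. Assume that $\sum_{h=1}^H R(s_h,a_h)\le 1$ almost surely for all $P\in\mathcal P$, $R\in\mathcal R$, $\pi\in\Pi$, and that $\mathcal R$ is convex, i.e. closed under mixtures $\lambda R+(1-\lambda)R'$, $\lambda\in[0,1]$ (of the reward functions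 and of the feedback laws simultaneously). A model $M=(P,R)\in\mathcal M=\mathcal P\times\mathcal R$ assigns to $\pi\in\Pi$ the law $M(\cdot|\pi)$ of the observation $o=(\tau,f)$, $f\sim R(\cdot|\tau)$, and the value $V_M(\pi)=\mathbb E[\sum_{h}R(s_h,a_h)]$. Let $\mathrm{co}(\mathcal M)$ be the set of finite mixtures $\bar M(\cdot|\pi)$ of the observation laws of models in $\mathcal M$, and for $\eta>0$ $$\mathsf{DEC}^{\mathrm{KL}}_\eta(\mathcal M)=\sup_{\bar M\in\mathrm{co}(\mathcal M)}\ \inf_{p\in\Delta(\Pi)}\ \sup_{M\in\mathcal M}\ \mathbb E_{\pi\sim p}\Big[\max_{\pi'\in\Pi}V_M(\pi')-V_M(\pi)-\tfrac1\eta D_{\mathrm{KL}}\big(M(\cdot|\pi),\bar M(\cdot|\pi)\big)\Big].$$ **Hybrid problem.** The environment fixes $P^\star\in\mathcal P$ and a comparator $\pi^\star\in\Pi$, unknown to the learner. In each round $t=1,\dots,T$ an adversary picks $R_t\in\mathcal R$, possibly at random and depending on everything that happened in rounds $1,\dots,t-1$; the learner, knowing only $(\pi_i,o_i)_{i<t}$,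 picks $\pi_t\in\Pi$, possibly at random; then $o_t\sim M_t(\cdot|\pi_t)$ is observed, where $M_t=(P^\star,R_t)$. The regret is $\mathrm{Reg}(\pi^\star)=\sum_{t=1}^T\big(V_{M_t}(\pi^\star)-V_{M_t}(\pi_t)\big)$. **Corollary.** For all $T\in\mathbb N$ and $\eta>0$ there is an algorithm for the learner such that, for every $P^\star\in\mathcal P$, every $\pi^\star\in\Pi$ and every adversary, $$\mathbb E[\mathrm{Reg}(\pi^\star)]\le\frac{\log(|\Pi||\mathcal P|)}{\eta}+T\cdot\mathsf{DEC}^{\mathrm{KL}}_\eta(\mathcal M).$$ -/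

import Mathlib

open scoped ENNReal NNReal

noncomputable section

namespace HybridDEC

/-! ### General decision making -/

/-- A model of a decision making problem with policies `Pol` and observations `O`: the law
`M(· | π)` of the observation and the expected reward `V_M(π)` of every policy `π`. -/
structure Model (Pol O : Type*) where
  law : Pol → PMF O
  value : Pol → ℝ

/-- Kullback–Leibler divergence of two discrete distributions (all sets are measurable). -/
def kl {O : Type*} (p q : PMF O) : ℝ≥0∞ :=
  letI : MeasurableSpace O := ⊤
  InformationTheory.klDiv p.toMeasure q.toMeasure

/-- `co(𝓜)`: all finite mixtures of (the observation laws of) models in `𝓜`. -/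
def co {Pol O : Type*} (𝓜 : Set (Model Pol O)) : Set (Pol → PMF O) :=
  {Mbar | ∃ μ : PMF (Model Pol O), μ.support.Finite ∧ μ.support ⊆ 𝓜 ∧
    ∀ π, Mbar π = μ.bind fun M => M.law π}

/-- `𝔼_{π ∼ p} [V_M(π_M) - V_M(π) - (1/η) KL(M(·|π), Mbar(·|π))]`, a number in `[-∞, ∞)`.
Here `V_M(π_M) = max_π V_M(π)`. -/
def decObjective {Pol O : Type*} [Fintype Pol] (η : ℝ) (Mbar : Pol → PMF O) (p : PMF Pol)
    (M : Model Pol O) : EReal :=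
  ((∑ π, (p π).toReal * ((⨆ π', M.value π') - M.value π) : ℝ) : EReal)
    - ((ENNReal.ofReal η⁻¹ * ∑ π, p π * kl (M.law π) (Mbar π) : ℝ≥0∞) : EReal)

/-- The offset decision-estimation coefficient with KL divergence. -/
def DEC {Pol O : Type*} [Fintype Pol] (η : ℝ) (𝓜 : Set (Model Pol O)) : EReal :=
  ⨆ Mbar ∈ co 𝓜, ⨅ p : PMF Pol, ⨆ M ∈ 𝓜, decObjective η Mbar p M

/-! ### Markov decision processes -/

/-- A transition kernel `P(· | s, a)`. -/
abbrev Transition (S A : Type*) := S → A → PMF S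

/-- A policy `π(· | s)`; a deterministic policy is one whose values are point masses. -/
abbrev Policy (S A : Type*) := S → PMF A

/-- A trajectory `(s₁, a₁), …, (s_H, a_H)`. -/
abbrev Traj (S A : Type*) := List (S × A)

/-- The reward component of a model: the reward function `R(s, a)`, and the conditional law of
the reward feedback which the learner receives in an episode, given the trajectory.
Bandit feedback is the case where the feedback is the list of the realized rewards
`r₁, …, r_H`, whose conditional means are the `R(s_h, a_h)`. -/
structure Reward (S A F : Type*) where
  mean : S → A → ℝ
  feedback : Traj S A → PMF F

/-- Convexity of a reward space: it is closed under mixtures of its elements. -/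
def ConvexRewards {S A F : Type*} (𝓡 : Set (Reward S A F)) : Prop :=
  ∀ R ∈ 𝓡, ∀ R' ∈ 𝓡, ∀ a b : ℝ≥0, a + b = 1 → ∃ R'' ∈ 𝓡,
    (∀ s x, R''.mean s x = a * R.mean s x + b * R'.mean s x) ∧
    (∀ τ f, R''.feedback τ f = a * R.feedback τ f + b * R'.feedback τ f)

/-- The law of the trajectory of `H` steps from state `s`. -/
def trajLaw {S A : Type*} (P : Transition S A) (π : Policy S A) : ℕ → S → PMF (Traj S A)
  | 0, _ => PMF.pure []
  | H + 1, s =>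
    (π s).bind fun a => (P s a).bind fun s' =>
      (trajLaw P π H s').map fun τ => (s, a) :: τ

/-- The cumulative reward `∑_h R(s_h, a_h)` along a trajectory. -/
def cumReward {S A F : Type*} (R : Reward S A F) (τ : Traj S A) : ℝ :=
  (τ.map fun x => R.mean x.1 x.2).sum

/-- An observation: the trajectory of the episode together with the reward feedback. -/
abbrev Obs (S A F : Type*) := Traj S A × F

/-- The model `M = (P, R)` on the policy class `Pol`, for episodes of `H` steps from `s₁`. -/
def mdp {S A F : Type*} (H : ℕ) (s₁ : S) (Pol : Finset (Policy S A)) (P : Transition S A)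
    (R : Reward S A F) : Model Pol (Obs S A F) where
  law π := (trajLaw P π.1 H s₁).bind fun τ => (R.feedback τ).map fun f => (τ, f)
  value π := ∑' τ, (trajLaw P π.1 H s₁ τ).toReal * cumReward R τ

/-- The model class `𝓜 = 𝓟 × 𝓡`. -/
def mdpClass {S A F : Type*} (H : ℕ) (s₁ : S) (Pol : Finset (Policy S A))
    (𝓟 : Finset (Transition S A)) (𝓡 : Set (Reward S A F)) : Set (Model Pol (Obs S A F)) :=
  {M | ∃ P ∈ 𝓟, ∃ R ∈ 𝓡, M = mdp H s₁ Pol P R}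

/-! ### The interaction with fixed transition and adversarial rewards -/

/-- A (randomized) algorithm chooses `π_t` from the past policies and observations. -/
abbrev Algorithm {S A : Type*} (F : Type*) (Pol : Finset (Policy S A)) :=
  List (Pol × Obs S A F) → PMF Pol

/-- What happens in one round: the reward `R_t`, the policy `π_t`, the observation `o_t`. -/
abbrev Round {S A F : Type*} (Pol : Finset (Policy S A)) (𝓡 : Set (Reward S A F)) :=
  𝓡 × Pol × Obs S A F

/-- A (randomized, adaptive) adversary chooses `R_t ∈ 𝓡` from the whole past. -/
abbrev Adversary {S A F : Type*} (Pol : Finset (Policy S A)) (𝓡 : Set (Reward S A F)) :=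
  List (Round Pol 𝓡) → PMF 𝓡

/-- The law of the first `t` rounds. In each round the adversary and the algorithm choose `R_t`
and `π_t`, independently given the past, and `o_t ∼ M_t(· | π_t)` with `M_t = (P, R_t)`. -/
def historyLaw {S A F : Type*} (H : ℕ) (s₁ : S) {Pol : Finset (Policy S A)}
    {𝓡 : Set (Reward S A F)} (P : Transition S A) (alg : Algorithm F Pol)
    (adv : Adversary Pol 𝓡) : ℕ → PMF (List (Round Pol 𝓡))
  | 0 => PMF.pure []
  | t + 1 =>
    (historyLaw H s₁ P alg adv t).bind fun h =>
      (adv h).bind fun R =>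
        (alg (h.map fun x => x.2)).bind fun π =>
          ((mdp H s₁ Pol P R.1).law π).map fun o => h ++ [(R, π, o)]

/-- The regret `∑_t (V_{M_t}(π⋆) - V_{M_t}(π_t))` of a history. -/
def regret {S A F : Type*} (H : ℕ) (s₁ : S) {Pol : Finset (Policy S A)}
    {𝓡 : Set (Reward S A F)} (P : Transition S A) (πstar : Pol) (h : List (Round Pol 𝓡)) : ℝ :=
  (h.map fun x => (mdp H s₁ Pol P x.1.1).value πstar - (mdp H s₁ Pol P x.1.1).value x.2.1).sum

/-- The expected regret `𝔼[Reg(π⋆)]` after `T` rounds. -/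
def expectedRegret {S A F : Type*} (H : ℕ) (s₁ : S) {Pol : Finset (Policy S A)}
    {𝓡 : Set (Reward S A F)} (P : Transition S A) (alg : Algorithm F Pol)
    (adv : Adversary Pol 𝓡) (πstar : Pol) (T : ℕ) : ℝ :=
  ∑' h, (historyLaw H s₁ P alg adv T h).toReal * regret H s₁ P πstar h

end HybridDEC

end

/-! The unknowns of the learner are collected in the parameter `φ = (π⋆, P⋆)`. A learner with
belief `ρ` plays one round of a game in which it chooses a distribution `p` of the policy and a new
belief `q π o` after every outcome, while the environment chooses `φ` and a model `M` with parameter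
`φ`. By a minimax theorem the learner has a move for which the regret of the round is, in
expectation and against every `φ` and `M`, at most `DEC` plus the decrease of the loss
`η⁻¹ * -log` of the belief at `φ`. Indeed, if the environment moves first and randomly, the models
with a given parameter merge into a single one by convexity of the reward space; the posterior is
then the right new belief, since the expected decrease of its loss is `η⁻¹` times the divergence
between the model and the mixture, which is what `DEC` trades off against regret. Starting from the
uniform prior and summing over the rounds, the losses telescope to `log (|Π| |𝓟|) / η`.

The logarithmic loss is unbounded, so the minimax theorem is applied to its tangents, which are
affine and finite, on finitely many observations at a time.
-/

open scoped ENNReal NNReal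

noncomputable section

namespace HybridDEC

open MeasureTheory

/-! ### A minimax theorem -/

theorem exists_forall_nonpos_of_forall_sum_lt_of_fintype {E ι : Type*} [AddCommGroup E]
    [Module ℝ E] [TopologicalSpace E] [IsTopologicalAddGroup E] [ContinuousSMul ℝ E] [Fintype ι]
    [Nonempty ι] {X : Set E} (hXc : IsCompact X) {f : ι → E → ℝ} (hf : ∀ i, ConvexOn ℝ X (f i))
    (hfc : ∀ i, ContinuousOn (f i) X)
    (h : ∀ w ∈ stdSimplex ℝ ι, ∀ ε > 0, ∃ x ∈ X, ∑ i, w i * f i x < ε) :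
    ∃ x ∈ X, ∀ i, f i x ≤ 0 := by
  classical
  have hX : Convex ℝ X := (hf (Classical.arbitrary ι)).1
  have hΔ : (stdSimplex ℝ ι).Nonempty := ⟨_, single_mem_stdSimplex ℝ (Classical.arbitrary ι)⟩
  have hne : X.Nonempty := (h _ hΔ.some_mem 1 one_pos).imp fun x hx => hx.1
  obtain ⟨x, hx, w, hw, hsaddle⟩ := Sion.exists_isSaddlePointOn
    (f := fun x (w : ι → ℝ) => ∑ i, w i * f i x) hne hX hXc
    (fun w _ => ContinuousOn.lowerSemicontinuousOn <|
      continuousOn_finsetSum _ fun i _ => continuousOn_const.mul (hfc i))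
    (fun w hw => ConvexOn.quasiconvexOn <| by
      simpa only [Finset.sum_fn, smul_eq_mul] using Finset.sum_induction (fun i x => w i • f i x)
        (ConvexOn ℝ X) (fun _ _ => ConvexOn.add) (convexOn_const 0 hX)
        (fun i _ => (hf i).smul (hw.1 i)))
    (convex_stdSimplex ℝ ι) hΔ (isCompact_stdSimplex ℝ ι)
    (fun x _ => Continuous.continuousOn (by fun_prop) |>.upperSemicontinuousOn)
    (fun x _ => ConcaveOn.quasiconcaveOn <|
      ((Fintype.linearCombination ℝ fun i => f i x).concaveOn (convex_stdSimplex ℝ ι)))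
  refine ⟨x, hx, fun i => le_of_forall_pos_lt_add fun ε hε => ?_⟩
  obtain ⟨y, hy, hlt⟩ := h w hw ε hε
  have hle : f i x ≤ ∑ j, w j * f j y := by
    simpa [Pi.single_apply] using hsaddle y hy _ (single_mem_stdSimplex ℝ i)
  linarith

theorem exists_forall_nonpos_of_forall_sum_lt {E ι : Type*} [AddCommGroup E]
    [Module ℝ E] [TopologicalSpace E] [IsTopologicalAddGroup E] [ContinuousSMul ℝ E] [Nonempty ι]
    {X : Set E} (hXc : IsCompact X) {f : ι → E → ℝ} (hf : ∀ i, ConvexOn ℝ X (f i))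
    (hfc : ∀ i, ContinuousOn (f i) X)
    (h : ∀ (s : Finset ι), ∀ w ∈ stdSimplex ℝ s, ∀ ε > 0,
      ∃ x ∈ X, ∑ i : s, w i * f i x < ε) :
    ∃ x ∈ X, ∀ i, f i x ≤ 0 := by
  choose v hv hXv using fun i =>
    lowerSemicontinuousOn_iff_preimage_Iic.1 (hfc i).lowerSemicontinuousOn 0
  have mem_v {i : ι} {x : E} (hx : x ∈ X) : x ∈ v i ↔ f i x ≤ 0 := by
    simpa [hx] using (Set.ext_iff.1 (hXv i) x).symm
  obtain ⟨x, hx, hxv⟩ := hXc.inter_iInter_nonempty v hv fun s => by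
    obtain ⟨i₀⟩ := ‹Nonempty ι›
    classical
    have : Nonempty (insert i₀ s : Finset ι) := ⟨⟨i₀, Finset.mem_insert_self i₀ s⟩⟩
    obtain ⟨x, hx, hxf⟩ := exists_forall_nonpos_of_forall_sum_lt_of_fintype hXc
      (fun i : (insert i₀ s : Finset ι) => hf i) (fun i => hfc i) (h _)
    exact ⟨x, hx, Set.mem_iInter₂.2 fun i hi =>
      (mem_v hx).2 (hxf ⟨i, Finset.mem_insert_of_mem hi⟩)⟩
  exact ⟨x, hx, fun i => (mem_v hx).1 (Set.mem_iInter.1 hxv i)⟩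

/-! ### Divergence and logarithmic loss -/

theorem toMeasure_eq_sum_dirac {O : Type*} [MeasurableSpace O] (p : PMF O) :
    p.toMeasure = Measure.sum fun o => p o • Measure.dirac o := by
  ext s hs
  simp only [Measure.sum_apply _ hs, p.toMeasure_apply hs, Measure.smul_apply,
    Measure.dirac_apply' _ hs, smul_eq_mul]
  exact tsum_congr fun o => by by_cases ho : o ∈ s <;> simp [ho]

section KL

variable {O : Type*} [MeasurableSpace O] [DiscreteMeasurableSpace O] {p q : PMF O}

theorem toMeasure_eq_withDensity_div (h : ∀ o, q o = 0 → p o = 0) :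
    p.toMeasure = q.toMeasure.withDensity fun o => p o / q o := by
  rw [toMeasure_eq_sum_dirac p, toMeasure_eq_sum_dirac q, withDensity_sum]
  congr with o : 1
  rw [withDensity_smul_measure, dirac_withDensity, smul_smul,
    ENNReal.mul_div_cancel' (fun hq => h o hq) fun hq => absurd hq (q.apply_ne_top o)]

theorem hasSum_toReal_mul_of_integrable {f : O → ℝ} (hf : Integrable f p.toMeasure) :
    HasSum (fun o => (p o).toReal * f o) (∫ o, f o ∂p.toMeasure) := by
  rw [toMeasure_eq_sum_dirac p] at hf ⊢
  simpa only [integral_smul_measure, integral_dirac, smul_eq_mul] using hasSum_integral_measure hf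

theorem rnDeriv_toMeasure_ae_eq_div (h : ∀ o, q o = 0 → p o = 0) :
    p.toMeasure.rnDeriv q.toMeasure =ᵐ[q.toMeasure] fun o => p o / q o := by
  rw [toMeasure_eq_withDensity_div h]
  exact Measure.rnDeriv_withDensity _ (.of_discrete)

theorem toMeasure_absolutelyContinuous (h : ∀ o, q o = 0 → p o = 0) :
    p.toMeasure ≪ q.toMeasure := by
  rw [toMeasure_eq_withDensity_div h]
  exact withDensity_absolutelyContinuous _ _

end KL

theorem kl_self {O : Type*} (p : PMF O) : kl p p = 0 :=
  letI : MeasurableSpace O := ⊤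
  InformationTheory.klDiv_self p.toMeasure

theorem hasSum_kl {O : Type*} {p q : PMF O} (h : ∀ o, q o = 0 → p o = 0) (hkl : kl p q ≠ ∞) :
    HasSum (fun o => (p o).toReal * Real.log ((p o).toReal / (q o).toReal)) (kl p q).toReal := by
  let _ : MeasurableSpace O := ⊤
  have hac : p.toMeasure ≪ q.toMeasure := toMeasure_absolutelyContinuous h
  have hllr : llr p.toMeasure q.toMeasure =ᵐ[p.toMeasure]
      fun o => Real.log ((p o).toReal / (q o).toReal) := by
    filter_upwards [hac.ae_le (rnDeriv_toMeasure_ae_eq_div h)] with o ho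
    rw [llr, ho, ENNReal.toReal_div]
  rw [kl, InformationTheory.toReal_klDiv_of_measure_eq hac (by simp), integral_congr_ae hllr]
  exact hasSum_toReal_mul_of_integrable
    ((integrable_congr hllr).1 (InformationTheory.klDiv_ne_top_iff.1 hkl).2)

theorem kl_ne_top_of_mul_le {O : Type*} {p q : PMF O} {W : ℝ≥0∞} (hW : W ≠ 0)
    (hW' : W ≠ ∞) (h : ∀ o, W * p o ≤ q o) : kl p q ≠ ∞ := by
  let _ : MeasurableSpace O := ⊤
  have hq : ∀ o, q o = 0 → p o = 0 := fun o ho => by simpa [ho, hW] using h o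
  have hdiv : ∀ o, p o / q o ≤ W⁻¹ := fun o =>
    ENNReal.div_le_of_le_mul ((ENNReal.mul_le_iff_le_inv hW hW').1 (h o))
  obtain ⟨C, hC⟩ := (isCompact_Icc (a := (0 : ℝ)) (b := W⁻¹.toReal)).exists_bound_of_continuousOn
    InformationTheory.continuous_klFun.continuousOn
  refine ne_top_of_le_ne_top (b := ENNReal.ofReal C) ENNReal.ofReal_ne_top ?_
  calc kl p q = ∫⁻ o, ENNReal.ofReal (InformationTheory.klFun (p o / q o).toReal) ∂q.toMeasure := by
        rw [kl, InformationTheory.klDiv_eq_lintegral_klFun_of_ac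
          (toMeasure_absolutelyContinuous hq)]
        refine lintegral_congr_ae ?_
        filter_upwards [rnDeriv_toMeasure_ae_eq_div hq] with o ho
        rw [ho]
    _ ≤ ∫⁻ _, ENNReal.ofReal C ∂q.toMeasure := lintegral_mono fun o =>
        ENNReal.ofReal_le_ofReal <| (le_abs_self _).trans <|
          hC _ ⟨ENNReal.toReal_nonneg, ENNReal.toReal_mono (by simpa using hW) (hdiv o)⟩
    _ = ENNReal.ofReal C := by simp

theorem hasSum_toReal {O : Type*} (p : PMF O) : HasSum (fun o => (p o).toReal) 1 := by
  simpa [← ENNReal.tsum_toReal_eq p.apply_ne_top] using ENNReal.hasSum_toReal p.tsum_coe_ne_top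

theorem neg_log_toReal_nonneg {u : ℝ≥0∞} (hu : u ≤ 1) : 0 ≤ -Real.log u.toReal :=
  neg_nonneg.2 (Real.log_nonpos ENNReal.toReal_nonneg (ENNReal.toReal_mono ENNReal.one_ne_top hu))

theorem sum_toReal_mul_neg_log_le {O : Type*} {p q : PMF O} {W : ℝ≥0∞} (hW : W ≠ 0)
    (hW' : W ≠ ∞) (h : ∀ o, W * p o ≤ q o) (s : Finset O) :
    ∑ o ∈ s, (p o).toReal * -Real.log (W * p o / q o).toReal ≤
      -Real.log W.toReal - (kl p q).toReal := by
  have hq : ∀ o, q o = 0 → p o = 0 := fun o ho => by simpa [ho, hW] using h o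
  have hterm (o : O) : (p o).toReal * -Real.log (W * p o / q o).toReal =
      (p o).toReal * -Real.log W.toReal
        - (p o).toReal * Real.log ((p o).toReal / (q o).toReal) := by
    by_cases hpo : p o = 0
    · simp [hpo]
    have hW₀ := ENNReal.toReal_pos hW hW'
    have hp₀ := ENNReal.toReal_pos hpo (p.apply_ne_top o)
    have hq₀ := ENNReal.toReal_pos (fun h => hpo (hq o h)) (q.apply_ne_top o)
    rw [ENNReal.toReal_div, ENNReal.toReal_mul, mul_div_assoc, Real.log_mul hW₀.ne'
      (div_pos hp₀ hq₀).ne']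
    ring
  have hsum : HasSum (fun o => (p o).toReal * -Real.log (W * p o / q o).toReal)
      (-Real.log W.toReal - (kl p q).toReal) := by
    simpa only [hterm, one_mul] using ((hasSum_toReal p).mul_right (-Real.log W.toReal)).sub
      (hasSum_kl hq (kl_ne_top_of_mul_le hW hW' h))
  refine sum_le_hasSum s (fun o _ => mul_nonneg ENNReal.toReal_nonneg ?_) hsum
  exact neg_log_toReal_nonneg (ENNReal.div_le_of_le_mul (by simpa using h o))

theorem sum_mul_neg_log_le_sum_mul_neg_log {ι : Type*} [Fintype ι] {W ρ : ι → ℝ}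
    (hW : W ∈ stdSimplex ℝ ι) (hρ : ρ ∈ stdSimplex ℝ ι) (hWρ : ∀ i, W i ≠ 0 → ρ i ≠ 0) :
    ∑ i, W i * -Real.log (W i) ≤ ∑ i, W i * -Real.log (ρ i) := by
  have key : ∀ i, W i * -Real.log (W i) ≤ W i * -Real.log (ρ i) + (ρ i - W i) := fun i => by
    rcases eq_or_ne (W i) 0 with h0 | h0
    · simpa [h0] using hρ.1 i
    have hW₀ : 0 < W i := (hW.1 i).lt_of_ne' h0
    have hρ₀ : 0 < ρ i := (hρ.1 i).lt_of_ne' (hWρ i h0)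
    have hlog := mul_le_mul_of_nonneg_left
      (Real.log_le_sub_one_of_pos (div_pos hρ₀ hW₀)) hW₀.le
    rw [Real.log_div hρ₀.ne' h0, mul_sub, mul_sub, mul_div_cancel₀ _ h0] at hlog
    linarith
  calc ∑ i, W i * -Real.log (W i)
      ≤ ∑ i, (W i * -Real.log (ρ i) + (ρ i - W i)) := Finset.sum_le_sum fun i _ => key i
    _ = ∑ i, W i * -Real.log (ρ i) := by
      rw [Finset.sum_add_distrib, Finset.sum_sub_distrib, hρ.2, hW.2, sub_self, add_zero]

/-- The logarithmic loss `-log u` of a probability `u`, with value `∞` at `u = 0`. -/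
def negLog (u : ℝ≥0∞) : ℝ≥0∞ :=
  (-u.log).toENNReal

theorem negLog_zero : negLog 0 = ∞ := by
  simp [negLog]

theorem negLog_of_ne_zero {u : ℝ≥0∞} (h0 : u ≠ 0) (htop : u ≠ ∞) :
    negLog u = ENNReal.ofReal (-Real.log u.toReal) := by
  rw [negLog, ENNReal.log_pos_real h0 htop, ← EReal.coe_neg, EReal.real_coe_toENNReal]

theorem continuous_negLog : Continuous negLog :=
  EReal.continuous_toENNReal.comp (continuous_neg.comp ENNReal.continuous_log)

theorem ofReal_sum_toReal_mul {α : Type*} (p : PMF α) (s : Finset α) {f : α → ℝ}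
    (hf : ∀ a, 0 ≤ f a) :
    ENNReal.ofReal (∑ a ∈ s, (p a).toReal * f a) = ∑ a ∈ s, p a * ENNReal.ofReal (f a) := by
  rw [ENNReal.ofReal_sum_of_nonneg fun a _ => mul_nonneg ENNReal.toReal_nonneg (hf a)]
  simp only [ENNReal.ofReal_mul ENNReal.toReal_nonneg, ENNReal.ofReal_toReal (p.apply_ne_top _)]

theorem toReal_mem_stdSimplex {ι : Type*} [Fintype ι] (p : PMF ι) :
    (fun i => (p i).toReal) ∈ stdSimplex ℝ ι :=
  ⟨fun _ => ENNReal.toReal_nonneg, (hasSum_fintype _).unique (hasSum_toReal p)⟩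

theorem exists_pmf_toReal_eq {ι : Type*} [Fintype ι] {w : ι → ℝ} (hw : w ∈ stdSimplex ℝ ι) :
    ∃ p : PMF ι, ∀ i, (p i).toReal = w i :=
  ⟨PMF.ofFintype (fun i => ENNReal.ofReal (w i)) <| by
    rw [← ENNReal.ofReal_sum_of_nonneg fun i _ => hw.1 i, hw.2, ENNReal.ofReal_one],
    fun i => ENNReal.toReal_ofReal (hw.1 i)⟩

/-- The posterior distribution of a parameter with prior `W`, given an observation whose law under
the parameter `φ` is `L φ`. An observation of probability zero leaves the prior unchanged. -/
def posterior {Φ O : Type*} (W : PMF Φ) (L : Φ → PMF O) (o : O) : PMF Φ :=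
  open Classical in
  if h : ∑' φ, W φ * L φ o = 0 then W
  else PMF.normalize (fun φ => W φ * L φ o) h (W.bind_apply L o ▸ (W.bind L).apply_ne_top o)

theorem posterior_apply {Φ O : Type*} {W : PMF Φ} {L : Φ → PMF O} {o : O} (h : W.bind L o ≠ 0)
    (φ : Φ) : posterior W L o φ = W φ * L φ o / W.bind L o := by
  rw [PMF.bind_apply] at h ⊢
  rw [posterior, dif_neg h, PMF.normalize_apply, div_eq_mul_inv]

theorem mul_apply_le_bind_apply {Φ O : Type*} (W : PMF Φ) (L : Φ → PMF O) (φ : Φ) (o : O) :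
    W φ * L φ o ≤ W.bind L o := by
  rw [PMF.bind_apply]
  exact ENNReal.le_tsum φ

theorem posterior_apply_ne_zero {Φ O : Type*} {W : PMF Φ} {L : Φ → PMF O} {φ : Φ} {o : O}
    (hW : W φ ≠ 0) (hL : L φ o ≠ 0) : posterior W L o φ ≠ 0 := by
  have hmul := mul_ne_zero hW hL
  rw [posterior_apply ((pos_iff_ne_zero.2 hmul).trans_le (mul_apply_le_bind_apply W L φ o)).ne']
  exact (ENNReal.div_pos hmul ((W.bind L).apply_ne_top o)).ne'

theorem sum_toReal_mul_neg_log_posterior_le {Φ O : Type*} {W : PMF Φ} (L : Φ → PMF O) {φ : Φ}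
    (hW : W φ ≠ 0) (s : Finset O) :
    ∑ o ∈ s, (L φ o).toReal * -Real.log (posterior W L o φ).toReal ≤
      -Real.log (W φ).toReal - (kl (L φ) (W.bind L)).toReal := by
  refine le_of_eq_of_le (Finset.sum_congr rfl fun o _ => ?_)
    (sum_toReal_mul_neg_log_le hW (W.apply_ne_top φ) (mul_apply_le_bind_apply W L φ) s)
  by_cases hL : L φ o = 0
  · simp [hL]
  · have := (pos_iff_ne_zero.2 (mul_ne_zero hW hL)).trans_le (mul_apply_le_bind_apply W L φ o)
    rw [posterior_apply this.ne']

/-! ### A single round against an arbitrary model -/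

section SingleRound

variable {Pol O Φ : Type*}

/-- A model as a point of a vector space, in which mixtures of models are convex combinations. -/
def Model.coords (M : Model Pol O) : (Pol → O → ℝ) × (Pol → ℝ) :=
  (fun π o => (M.law π o).toReal, M.value)

theorem exists_forall_smul_eq_sum {ι V : Type*} [AddCommGroup V] [Module ℝ V] {K : Set V}
    (hK : Convex ℝ K) (hne : K.Nonempty) {s : Finset ι} {w : ι → ℝ}
    (hw : ∀ i ∈ s, 0 ≤ w i) {z : ι → V} (hz : ∀ i ∈ s, z i ∈ K) :
    ∃ y ∈ K, (∑ i ∈ s, w i) • y = ∑ i ∈ s, w i • z i := by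
  rcases (Finset.sum_nonneg hw).eq_or_lt with h0 | hpos
  · obtain ⟨y, hy⟩ := hne
    refine ⟨y, hy, ?_⟩
    rw [← h0, zero_smul, Finset.sum_eq_zero fun i hi => ?_]
    rw [(Finset.sum_eq_zero_iff_of_nonneg hw).1 h0.symm i hi, zero_smul]
  · exact ⟨s.centerMass w z, hK.centerMass_mem hw hpos hz, by
      rw [Finset.centerMass, smul_inv_smul₀ hpos.ne']⟩

theorem exists_mixture_smul_coords_eq_sum {ι : Type*} [Fintype ι] [Finite Φ] [DecidableEq Φ]
    {K : Φ → Set (Model Pol O)} (hne : ∀ φ, (K φ).Nonempty)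
    (hconv : ∀ φ, Convex ℝ (Model.coords '' K φ)) {w : ι → ℝ} (hw : w ∈ stdSimplex ℝ ι)
    (par : ι → Φ) {N : ι → Model Pol O}
    (hN : ∀ i, N i ∈ K (par i)) :
    ∃ (W : PMF Φ) (M : Φ → Model Pol O), (∀ φ, M φ ∈ K φ) ∧
      (∀ φ, (W φ).toReal = ∑ i with par i = φ, w i) ∧
      ∀ φ, (W φ).toReal • (M φ).coords = ∑ i with par i = φ, w i • (N i).coords := by
  have := Fintype.ofFinite Φ
  obtain ⟨W, hW⟩ := exists_pmf_toReal_eq (w := fun φ => ∑ i with par i = φ, w i)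
    ⟨fun φ => Finset.sum_nonneg fun i _ => hw.1 i, by rw [Finset.sum_fiberwise, hw.2]⟩
  choose y hy hyw using fun φ => exists_forall_smul_eq_sum (hconv φ) ((hne φ).image _)
    (s := Finset.univ.filter fun i => par i = φ) (fun i _ => hw.1 i)
    (z := fun i => (N i).coords)
    (fun i hi => (Finset.mem_filter.1 hi).2 ▸ Set.mem_image_of_mem _ (hN i))
  choose M hM hMy using hy
  exact ⟨W, M, hM, hW, fun φ => by rw [hW, hMy, hyw]⟩

theorem law_ne_zero_of_smul_coords_eq_sum {ι : Type*} {s : Finset ι} {w : ι → ℝ}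
    (hw : ∀ i, 0 ≤ w i) {N : ι → Model Pol O} {M : Model Pol O} {a : ℝ}
    (h : a • M.coords = ∑ i ∈ s, w i • (N i).coords) {i : ι} (hi : i ∈ s) (hwi : w i ≠ 0)
    {π : Pol} {o : O} (hNi : (N i).law π o ≠ 0) : M.law π o ≠ 0 := by
  intro hM
  have hsum : ∑ i ∈ s, w i * ((N i).law π o).toReal = 0 := by
    simpa [Model.coords, hM, Prod.fst_sum] using (congr_fun₂ (congr_arg Prod.fst h) π o).symm
  have := (Finset.sum_eq_zero_iff_of_nonneg fun i _ =>
    mul_nonneg (hw i) ENNReal.toReal_nonneg).1 hsum i hi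
  exact mul_ne_zero hwi (ENNReal.toReal_pos hNi ((N i).law π |>.apply_ne_top o)).ne' this

/-- The logarithmic loss of the beliefs `q π o` at the parameter `φ`, weighted with the probability
`p π` of playing `π`. -/
def logLoss (p : PMF Pol) (q : Pol → O → PMF Φ) (φ : Φ) (π : Pol) (o : O) : ℝ :=
  (p π).toReal * -Real.log (q π o φ).toReal

/-- The learner's move in a single round: a distribution `p` of the policy, together with the
weights `r π o φ = p π * q π o φ`, where `q π o` is the belief about the parameter after playing `π`
and observing `o`. In the coordinates `(p, r)` tangents of the logarithmic loss are linear, which is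
not the case in `(p, q)`. -/
def jointStrategy (p : PMF Pol) (q : Pol → O → PMF Φ) : (Pol → ℝ) × (Pol → O → Φ → ℝ) :=
  (fun π => (p π).toReal, fun π o φ => (p π).toReal * (q π o φ).toReal)

theorem logLoss_nonneg (p : PMF Pol) (q : Pol → O → PMF Φ) (φ : Φ) (π : Pol) (o : O) :
    0 ≤ logLoss p q φ π o :=
  mul_nonneg ENNReal.toReal_nonneg (neg_log_toReal_nonneg ((q π o).coe_le_one φ))

/-- The tangent at `u = t` of the loss `-p * log u`, evaluated at `u = r / p`, for the
move `(p, r) = x`: an affine minorant of the logarithmic loss. -/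
def tangentLoss (φ : Φ) (t : Pol → O → ℝ) (x : (Pol → ℝ) × (Pol → O → Φ → ℝ)) (π : Pol) (o : O) :
    ℝ :=
  x.1 π * (1 - Real.log (t π o)) - x.2 π o φ / t π o

theorem tangentLoss_jointStrategy_le {φ : Φ} {t : Pol → O → ℝ} {p : PMF Pol}
    {q : Pol → O → PMF Φ} {π : Pol} {o : O} (ht : 0 < t π o) (hq : q π o φ ≠ 0) :
    tangentLoss φ t (jointStrategy p q) π o ≤ logLoss p q φ π o := by
  have hu : 0 < (q π o φ).toReal := ENNReal.toReal_pos hq ((q π o).apply_ne_top φ)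
  have hlog := Real.log_le_sub_one_of_pos (div_pos hu ht)
  rw [Real.log_div hu.ne' ht.ne'] at hlog
  calc tangentLoss φ t (jointStrategy p q) π o
      = (p π).toReal * (1 - Real.log (t π o) - (q π o φ).toReal / t π o) := by
        simp only [tangentLoss, jointStrategy]
        ring
    _ ≤ logLoss p q φ π o :=
        mul_le_mul_of_nonneg_left (by linarith) ENNReal.toReal_nonneg

theorem mul_neg_log_le_tangentLoss {φ : Φ} {t : Pol → O → ℝ} {p : PMF Pol}
    {q : Pol → O → PMF Φ} {π : Pol} {o : O} (ht : 0 < t π o) (hq : (q π o φ).toReal ≤ t π o) :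
    (p π).toReal * -Real.log (t π o) ≤ tangentLoss φ t (jointStrategy p q) π o := by
  have hdiv := (div_le_one ht).2 hq
  calc (p π).toReal * -Real.log (t π o)
      ≤ (p π).toReal * (1 - Real.log (t π o) - (q π o φ).toReal / t π o) :=
        mul_le_mul_of_nonneg_left (by linarith) ENNReal.toReal_nonneg
    _ = tangentLoss φ t (jointStrategy p q) π o := by
        simp only [tangentLoss, jointStrategy]
        ring

variable [Fintype Pol]

/-- The expected regret against the policy `star` plus `η⁻¹` times the expected loss of an
observation in `s`, as a linear functional of the coordinates of the model. The loss `ℓ π o` is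
already weighted with the probability `p π` of playing `π`. -/
def roundLoss (η : ℝ) (star : Pol) (s : Finset O) (p : Pol → ℝ) (ℓ : Pol → O → ℝ) :
    ((Pol → O → ℝ) × (Pol → ℝ)) →ₗ[ℝ] ℝ where
  toFun v := ∑ π, p π * (v.2 star - v.2 π) + η⁻¹ * ∑ π, ∑ o ∈ s, v.1 π o * ℓ π o
  map_add' v v' := by
    simp only [Prod.snd_add, Prod.fst_add, Pi.add_apply, add_mul, Finset.sum_add_distrib,
      add_sub_add_comm, mul_add]
    ring
  map_smul' a v := by
    simp only [Prod.smul_snd, Prod.smul_fst, Pi.smul_apply, smul_eq_mul, mul_add, Finset.mul_sum,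
      RingHom.id_apply, ← mul_sub, mul_assoc, mul_left_comm a]

theorem roundLoss_coords_mono {η : ℝ} (hη : 0 < η) (star : Pol) {s s' : Finset O} (hs : s ⊆ s')
    (p : Pol → ℝ) {ℓ ℓ' : Pol → O → ℝ} {M : Model Pol O}
    (hℓ : ∀ π o, M.law π o ≠ 0 → ℓ π o ≤ ℓ' π o) (hℓ' : ∀ π o, 0 ≤ ℓ' π o) :
    roundLoss η star s p ℓ M.coords ≤ roundLoss η star s' p ℓ' M.coords := by
  have := inv_pos.2 hη
  simp only [roundLoss, LinearMap.coe_mk, AddHom.coe_mk, Model.coords]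
  gcongr _ + _ * ∑ π, ?_ with π
  calc ∑ o ∈ s, (M.law π o).toReal * ℓ π o ≤ ∑ o ∈ s, (M.law π o).toReal * ℓ' π o := by
        refine Finset.sum_le_sum fun o _ => ?_
        by_cases h : M.law π o = 0
        · simp [h]
        · exact mul_le_mul_of_nonneg_left (hℓ π o h) ENNReal.toReal_nonneg
    _ ≤ ∑ o ∈ s', (M.law π o).toReal * ℓ' π o :=
        Finset.sum_le_sum_of_subset_of_nonneg hs fun o _ _ =>
          mul_nonneg ENNReal.toReal_nonneg (hℓ' π o)

theorem exists_decObjective_le {η c : ℝ} [Finite Φ] {𝓜 : Set (Model Pol O)}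
    (h : DEC η 𝓜 < c) (W : PMF Φ) {M : Φ → Model Pol O} (hM : ∀ φ, M φ ∈ 𝓜) :
    ∃ p : PMF Pol, ∀ φ, decObjective η (fun π => W.bind fun φ => (M φ).law π) p (M φ) ≤ c := by
  have hco : (fun π => W.bind fun φ => (M φ).law π) ∈ co 𝓜 := by
    refine ⟨W.map M, ?_, ?_, fun π => by rw [PMF.bind_map]; rfl⟩
    · rw [PMF.support_map]
      exact Set.toFinite _
    · rw [PMF.support_map]
      exact Set.image_subset_iff.2 fun φ _ => hM φ
  obtain ⟨p, hp⟩ := iInf_lt_iff.1 ((le_iSup₂ _ hco).trans_lt h)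
  exact ⟨p, fun φ => (le_iSup₂ (M φ) (hM φ)).trans hp.le⟩

theorem sum_sub_sum_kl_le_of_decObjective_le {η c : ℝ} (hη : 0 < η) {Mbar : Pol → PMF O}
    {p : PMF Pol} {M : Model Pol O} (hkl : ∀ π, kl (M.law π) (Mbar π) ≠ ∞)
    (h : decObjective η Mbar p M ≤ c) (star : Pol) :
    ∑ π, (p π).toReal * (M.value star - M.value π)
      - η⁻¹ * ∑ π, (p π).toReal * (kl (M.law π) (Mbar π)).toReal ≤ c := by
  have hpkl (π : Pol) : p π * kl (M.law π) (Mbar π) ≠ ∞ :=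
    ENNReal.mul_ne_top (p.apply_ne_top π) (hkl π)
  have hsum : ((ENNReal.ofReal η⁻¹ * ∑ π, p π * kl (M.law π) (Mbar π) : ℝ≥0∞) : EReal) =
      ((η⁻¹ * ∑ π, (p π).toReal * (kl (M.law π) (Mbar π)).toReal : ℝ) : EReal) := by
    rw [← EReal.coe_ennreal_toReal (ENNReal.mul_ne_top ENNReal.ofReal_ne_top
      (ENNReal.sum_ne_top.2 fun π _ => hpkl π)), ENNReal.toReal_mul,
      ENNReal.toReal_ofReal (inv_nonneg.2 hη.le), ENNReal.toReal_sum fun π _ => hpkl π]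
    simp only [ENNReal.toReal_mul]
  rw [decObjective, hsum, ← EReal.coe_sub, EReal.coe_le_coe_iff] at h
  refine le_trans ?_ h
  gcongr with π
  exact le_ciSup (Set.finite_range M.value).bddAbove star

theorem roundLoss_logLoss_posterior_le {η c : ℝ} (hη : 0 < η) {W : PMF Φ} {M : Φ → Model Pol O}
    {p : PMF Pol} {φ : Φ} (hW : W φ ≠ 0)
    (h : decObjective η (fun π => W.bind fun φ => (M φ).law π) p (M φ) ≤ c) (star : Pol)
    (s : Finset O) :
    roundLoss η star s (fun π => (p π).toReal)
        (logLoss p (fun π => posterior W fun φ => (M φ).law π) φ) (M φ).coords ≤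
      c + η⁻¹ * -Real.log (W φ).toReal := by
  have hkl (π : Pol) : kl ((M φ).law π) (W.bind fun φ => (M φ).law π) ≠ ∞ :=
    kl_ne_top_of_mul_le hW (W.apply_ne_top φ) (mul_apply_le_bind_apply W (fun φ => (M φ).law π) φ)
  have hdec := sum_sub_sum_kl_le_of_decObjective_le hη hkl h star
  have hlog : ∑ π, ∑ o ∈ s, ((M φ).law π o).toReal *
        logLoss p (fun π => posterior W fun φ => (M φ).law π) φ π o ≤
      -Real.log (W φ).toReal
        - ∑ π, (p π).toReal * (kl ((M φ).law π) (W.bind fun φ => (M φ).law π)).toReal :=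
    calc _ = ∑ π, (p π).toReal * ∑ o ∈ s, ((M φ).law π o).toReal *
          -Real.log (posterior W (fun φ => (M φ).law π) o φ).toReal := by
          simp only [logLoss, Finset.mul_sum, mul_left_comm]
      _ ≤ ∑ π, (p π).toReal * (-Real.log (W φ).toReal
          - (kl ((M φ).law π) (W.bind fun φ => (M φ).law π)).toReal) := by
          gcongr with π
          exact sum_toReal_mul_neg_log_posterior_le (fun φ => (M φ).law π) hW s
      _ = _ := by
          simp only [mul_sub, Finset.sum_sub_distrib, ← Finset.sum_mul,
            (toReal_mem_stdSimplex p).2, one_mul]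
  have := mul_le_mul_of_nonneg_left hlog (inv_nonneg.2 hη.le)
  simp only [roundLoss, LinearMap.coe_mk, AddHom.coe_mk, Model.coords]
  linarith

/-- A constraint on the learner's move in a single round: against the parameter `param` of positive
prior probability and the model `model`, counting only the observations in `obs` and replacing the
logarithmic loss with its tangent at `scale`. -/
structure Test (K : Φ → Set (Model Pol O)) (ρ : PMF Φ) where
  param : Φ
  prior_ne_zero : ρ param ≠ 0
  model : Model Pol O
  model_mem : model ∈ K param
  obs : Finset O
  scale : Pol → O → ℝ
  scale_pos : ∀ π o, 0 < scale π o

namespace Test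

variable {K : Φ → Set (Model Pol O)} {ρ : PMF Φ} (i : Test K ρ) (η c : ℝ) (star : Φ → Pol)

/-- The amount by which the move `x` violates the constraint. -/
def excess (x : (Pol → ℝ) × (Pol → O → Φ → ℝ)) : ℝ :=
  roundLoss η (star i.param) i.obs x.1 (tangentLoss i.param i.scale x) i.model.coords
    - (c + η⁻¹ * -Real.log (ρ i.param).toReal)

theorem convexOn_excess {X : Set ((Pol → ℝ) × (Pol → O → Φ → ℝ))} (hX : Convex ℝ X) :
    ConvexOn ℝ X (i.excess η c star) := by
  refine ConvexOn.add ?_ (convexOn_const _ hX)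
  refine (IsLinearMap.mk' (fun x => roundLoss η (star i.param) i.obs x.1
    (tangentLoss i.param i.scale x) i.model.coords) ⟨fun x y => ?_, fun a x => ?_⟩).convexOn hX
  · simp only [roundLoss, LinearMap.coe_mk, AddHom.coe_mk, tangentLoss, Prod.fst_add, Prod.snd_add,
      Pi.add_apply, add_mul, add_div, add_sub_add_comm, mul_add, Finset.sum_add_distrib]
    ring
  · simp only [roundLoss, LinearMap.coe_mk, AddHom.coe_mk, tangentLoss, Prod.smul_fst,
      Prod.smul_snd, Pi.smul_apply, smul_eq_mul, mul_add, Finset.mul_sum, mul_assoc, mul_div_assoc,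
      ← mul_sub, mul_left_comm _ a]

theorem continuous_excess : Continuous (i.excess η c star) := by
  unfold excess roundLoss tangentLoss
  simp only [LinearMap.coe_mk, AddHom.coe_mk]
  fun_prop

end Test

theorem sum_sub_add_sum_neg_log_le {η c : ℝ} (hη : 0 < η) {star : Φ → Pol}
    {K : Φ → Set (Model Pol O)} {ρ : PMF Φ} {p : PMF Pol} {q : Pol → O → PMF Φ}
    (h : ∀ i : Test K ρ, i.excess η c star (jointStrategy p q) ≤ 0)
    {φ : Φ} (hφ : ρ φ ≠ 0) {M : Model Pol O} (hM : M ∈ K φ) (s : Finset O) {v : Pol → O → ℝ}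
    (hqv : ∀ π o, (q π o φ).toReal ≤ v π o) (hv : ∀ π o, 0 < v π o) :
    ∑ π, (p π).toReal * (M.value (star φ) - M.value π)
        + η⁻¹ * ∑ π, (p π).toReal * ∑ o ∈ s, (M.law π o).toReal * -Real.log (v π o) ≤
      c + η⁻¹ * -Real.log (ρ φ).toReal := by
  have htangent : ∑ π, (p π).toReal * ∑ o ∈ s, (M.law π o).toReal * -Real.log (v π o) ≤
      ∑ π, ∑ o ∈ s, (M.law π o).toReal * tangentLoss φ v (jointStrategy p q) π o := by
    simp only [Finset.mul_sum, mul_left_comm (p _).toReal]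
    gcongr with π _ o
    exact mul_neg_log_le_tangentLoss (hv π o) (hqv π o)
  calc _ ≤ roundLoss η (star φ) s (fun π => (p π).toReal)
          (tangentLoss φ v (jointStrategy p q)) M.coords :=
        add_le_add le_rfl (mul_le_mul_of_nonneg_left htangent (inv_nonneg.2 hη.le))
    _ ≤ _ := sub_nonpos.1 (h ⟨φ, hφ, M, hM, s, v, hv⟩)

theorem sum_mul_add_sum_negLog_le {η c : ℝ} (hη : 0 < η) (hc : 0 ≤ c) {star : Φ → Pol}
    {K : Φ → Set (Model Pol O)} {ρ : PMF Φ} {p : PMF Pol} {q : Pol → O → PMF Φ}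
    (h : ∀ i : Test K ρ, i.excess η c star (jointStrategy p q) ≤ 0)
    {φ : Φ} (hφ : ρ φ ≠ 0) {M : Model Pol O} (hM : M ∈ K φ)
    (hV : ∀ π, M.value π ≤ 1 + M.value (star φ)) (s : Finset O) {v : Pol → O → ℝ≥0∞}
    (hqv : ∀ π o, q π o φ ≤ v π o) (hv0 : ∀ π o, v π o ≠ 0) (hv1 : ∀ π o, v π o ≤ 1) :
    ∑ π, p π * (ENNReal.ofReal (1 + M.value (star φ) - M.value π)
        + ENNReal.ofReal η⁻¹ * ∑ o ∈ s, M.law π o * negLog (v π o)) ≤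
      ENNReal.ofReal (1 + c) + ENNReal.ofReal η⁻¹ * negLog (ρ φ) := by
  have hv_top (π : Pol) (o : O) : v π o ≠ ∞ := ((hv1 π o).trans_lt ENNReal.one_lt_top).ne
  have hη' : 0 ≤ η⁻¹ := inv_nonneg.2 hη.le
  let loss (π : Pol) : ℝ := ∑ o ∈ s, (M.law π o).toReal * -Real.log (v π o).toReal
  have hloss (π : Pol) : 0 ≤ loss π := Finset.sum_nonneg fun o _ =>
    mul_nonneg ENNReal.toReal_nonneg (neg_log_toReal_nonneg (hv1 π o))
  have ofReal_loss (π : Pol) : ENNReal.ofReal (loss π) = ∑ o ∈ s, M.law π o * negLog (v π o) := by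
    simp only [loss, ofReal_sum_toReal_mul _ _ fun o => neg_log_toReal_nonneg (hv1 π o),
      negLog_of_ne_zero (hv0 π _) (hv_top π _)]
  have hreal : ∑ π, (p π).toReal * (1 + M.value (star φ) - M.value π + η⁻¹ * loss π) ≤
      1 + c + η⁻¹ * -Real.log (ρ φ).toReal := by
    have hle := sum_sub_add_sum_neg_log_le hη h hφ hM s
      (fun π o => ENNReal.toReal_mono (hv_top π o) (hqv π o))
      (fun π o => ENNReal.toReal_pos (hv0 π o) (hv_top π o))
    simp only [add_sub_assoc, mul_add, mul_one, mul_left_comm _ η⁻¹, ← Finset.mul_sum,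
      Finset.sum_add_distrib, (toReal_mem_stdSimplex p).2]
    linarith
  have hsub (π : Pol) : 0 ≤ 1 + M.value (star φ) - M.value π := sub_nonneg.2 (hV π)
  calc _ = ENNReal.ofReal
        (∑ π, (p π).toReal * (1 + M.value (star φ) - M.value π + η⁻¹ * loss π)) := by
        rw [ofReal_sum_toReal_mul _ _ fun π => add_nonneg (hsub π) (mul_nonneg hη' (hloss π))]
        simp only [ENNReal.ofReal_add (hsub _) (mul_nonneg hη' (hloss _)), ENNReal.ofReal_mul hη',
          ofReal_loss]
    _ ≤ ENNReal.ofReal (1 + c + η⁻¹ * -Real.log (ρ φ).toReal) := ENNReal.ofReal_le_ofReal hreal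
    _ = _ := by
        rw [ENNReal.ofReal_add (by positivity)
          (mul_nonneg hη' (neg_log_toReal_nonneg (ρ.coe_le_one φ))), ENNReal.ofReal_mul hη',
          negLog_of_ne_zero hφ (ρ.apply_ne_top φ)]


theorem sum_mul_roundLoss_logLoss_posterior_le [Fintype Φ] {η c : ℝ} (hη : 0 < η) {W ρ : PMF Φ}
    {M : Φ → Model Pol O} {p : PMF Pol}
    (h : ∀ φ, decObjective η (fun π => W.bind fun φ => (M φ).law π) p (M φ) ≤ c)
    (hWρ : ∀ φ, W φ ≠ 0 → ρ φ ≠ 0) (star : Φ → Pol) (s : Finset O) :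
    ∑ φ, (W φ).toReal * roundLoss η (star φ) s (fun π => (p π).toReal)
        (logLoss p (fun π => posterior W fun φ => (M φ).law π) φ) (M φ).coords ≤
      c + η⁻¹ * ∑ φ, (W φ).toReal * -Real.log (ρ φ).toReal := by
  have hround (φ : Φ) : (W φ).toReal * roundLoss η (star φ) s (fun π => (p π).toReal)
        (logLoss p (fun π => posterior W fun φ => (M φ).law π) φ) (M φ).coords ≤
      (W φ).toReal * (c + η⁻¹ * -Real.log (W φ).toReal) := by
    by_cases hφ : W φ = 0
    · simp [hφ]
    · gcongr
      exact roundLoss_logLoss_posterior_le hη hφ (h φ) (star φ) s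
  have toReal_ne_zero {μ : PMF Φ} {φ : Φ} : (μ φ).toReal ≠ 0 ↔ μ φ ≠ 0 := by
    simp [ENNReal.toReal_eq_zero_iff, μ.apply_ne_top]
  calc _ ≤ ∑ φ, (W φ).toReal * (c + η⁻¹ * -Real.log (W φ).toReal) :=
        Finset.sum_le_sum fun φ _ => hround φ
    _ = c + η⁻¹ * ∑ φ, (W φ).toReal * -Real.log (W φ).toReal := by
        simp only [mul_add, Finset.sum_add_distrib, ← Finset.sum_mul, (toReal_mem_stdSimplex W).2,
          one_mul, Finset.mul_sum, mul_left_comm η⁻¹]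
    _ ≤ c + η⁻¹ * ∑ φ, (W φ).toReal * -Real.log (ρ φ).toReal :=
        add_le_add le_rfl <| mul_le_mul_of_nonneg_left
          (sum_mul_neg_log_le_sum_mul_neg_log (toReal_mem_stdSimplex W) (toReal_mem_stdSimplex ρ)
            fun φ hφ => toReal_ne_zero.2 (hWρ φ (toReal_ne_zero.1 hφ)))
          (inv_nonneg.2 hη.le)

theorem exists_sum_mul_roundLoss_le [Finite Φ] {η c : ℝ} (hη : 0 < η) {𝓜 : Set (Model Pol O)}
    (hc : DEC η 𝓜 < c) {K : Φ → Set (Model Pol O)} (hK : ∀ φ, K φ ⊆ 𝓜)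
    (hne : ∀ φ, (K φ).Nonempty) (hconv : ∀ φ, Convex ℝ (Model.coords '' K φ)) (star : Φ → Pol)
    (ρ : PMF Φ) (s : Finset O) {ι : Type*} [Fintype ι] {w : ι → ℝ} (hw : w ∈ stdSimplex ℝ ι)
    {par : ι → Φ} (hρ : ∀ i, ρ (par i) ≠ 0) {N : ι → Model Pol O} (hN : ∀ i, N i ∈ K (par i)) :
    ∃ (p : PMF Pol) (q : Pol → O → PMF Φ),
      (∀ i, w i ≠ 0 → ∀ π o, (N i).law π o ≠ 0 → q π o (par i) ≠ 0) ∧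
      ∑ i, w i * roundLoss η (star (par i)) s (fun π => (p π).toReal) (logLoss p q (par i))
          (N i).coords ≤
        c + η⁻¹ * ∑ i, w i * -Real.log (ρ (par i)).toReal := by
  classical
  have := Fintype.ofFinite Φ
  obtain ⟨W, M, hMK, hW, hM⟩ := exists_mixture_smul_coords_eq_sum hne hconv hw par hN
  obtain ⟨p, hp⟩ := exists_decObjective_le hc W fun φ => hK φ (hMK φ)
  have hW_ne (i : ι) (hwi : w i ≠ 0) : W (par i) ≠ 0 := fun h => hwi <|
    (Finset.sum_eq_zero_iff_of_nonneg fun i _ => hw.1 i).1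
      (by simpa [h] using (hW (par i)).symm) i (by simp)
  have hWρ (φ : Φ) (hφ : W φ ≠ 0) : ρ φ ≠ 0 := by
    have hsum := (hW φ).symm.trans_ne (ENNReal.toReal_pos hφ (W.apply_ne_top φ)).ne'
    obtain ⟨i, hi, -⟩ := Finset.exists_ne_zero_of_sum_ne_zero hsum
    exact (Finset.mem_filter.1 hi).2 ▸ hρ i
  refine ⟨p, fun π => posterior W fun φ => (M φ).law π, fun i hwi π o hlaw =>
    posterior_apply_ne_zero (hW_ne i hwi)
      (law_ne_zero_of_smul_coords_eq_sum hw.1 (hM (par i)) (by simp) hwi hlaw), ?_⟩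
  have sum_par (f : Φ → ι → ℝ) : ∑ i, f (par i) i = ∑ φ, ∑ i with par i = φ, f φ i := by
    rw [← Finset.sum_fiberwise Finset.univ par]
    refine Finset.sum_congr rfl fun φ _ => Finset.sum_congr rfl fun i hi => ?_
    rw [(Finset.mem_filter.1 hi).2]
  calc _ = ∑ φ, (W φ).toReal * roundLoss η (star φ) s (fun π => (p π).toReal)
          (logLoss p (fun π => posterior W fun φ => (M φ).law π) φ) (M φ).coords := by
        rw [sum_par fun φ i => w i * roundLoss η (star φ) s (fun π => (p π).toReal)
          (logLoss p (fun π => posterior W fun φ => (M φ).law π) φ) (N i).coords]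
        simp only [← smul_eq_mul, ← map_smul, ← map_sum, hM]
    _ ≤ c + η⁻¹ * ∑ φ, (W φ).toReal * -Real.log (ρ φ).toReal :=
        sum_mul_roundLoss_logLoss_posterior_le hη hp hWρ star s
    _ = c + η⁻¹ * ∑ i, w i * -Real.log (ρ (par i)).toReal := by
        rw [sum_par fun φ i => w i * -Real.log (ρ φ).toReal]
        simp only [hW, Finset.sum_mul]

section JointStrategies

variable [Fintype Φ]

/-- The moves of the learner in a single round, in the coordinates of `jointStrategy`. -/
def jointStrategies (Pol O Φ : Type*) [Fintype Pol] [Fintype Φ] :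
    Set ((Pol → ℝ) × (Pol → O → Φ → ℝ)) :=
  {x | x.1 ∈ stdSimplex ℝ Pol ∧ ∀ π o, (∀ φ, 0 ≤ x.2 π o φ) ∧ ∑ φ, x.2 π o φ = x.1 π}

theorem jointStrategy_mem (p : PMF Pol) (q : Pol → O → PMF Φ) :
    jointStrategy p q ∈ jointStrategies Pol O Φ :=
  ⟨toReal_mem_stdSimplex p, fun π o => ⟨fun φ => by simp only [jointStrategy]; positivity, by
    simp only [jointStrategy, ← Finset.mul_sum, (toReal_mem_stdSimplex (q π o)).2, mul_one]⟩⟩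

theorem exists_jointStrategy_eq [Nonempty Φ] {x : (Pol → ℝ) × (Pol → O → Φ → ℝ)}
    (hx : x ∈ jointStrategies Pol O Φ) : ∃ p q, jointStrategy p q = x := by
  obtain ⟨p, hp⟩ := exists_pmf_toReal_eq hx.1
  have hq (π : Pol) (o : O) : ∃ q : PMF Φ, ∀ φ, x.1 π * (q φ).toReal = x.2 π o φ := by
    obtain ⟨hr, hsum⟩ := hx.2 π o
    rcases eq_or_ne (x.1 π) 0 with h0 | h0
    · rw [h0, Finset.sum_eq_zero_iff_of_nonneg fun φ _ => hr φ] at hsum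
      exact ⟨PMF.pure (Classical.arbitrary Φ), fun φ => by rw [h0, zero_mul, hsum φ (by simp)]⟩
    · obtain ⟨q, hq⟩ := exists_pmf_toReal_eq (w := fun φ => x.2 π o φ / x.1 π)
        ⟨fun φ => div_nonneg (hr φ) (hx.1.1 π), by rw [← Finset.sum_div, hsum, div_self h0]⟩
      exact ⟨q, fun φ => by rw [hq, mul_div_cancel₀ _ h0]⟩
  choose q hq using hq
  exact ⟨p, q, Prod.ext (funext hp) (by ext π o φ; simp only [jointStrategy, hp, hq])⟩

theorem convex_jointStrategies : Convex ℝ (jointStrategies Pol O Φ) := by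
  rintro x ⟨hx, hx'⟩ y ⟨hy, hy'⟩ a b ha hb hab
  refine ⟨convex_stdSimplex ℝ Pol hx hy ha hb hab, fun π o => ⟨fun φ => ?_, ?_⟩⟩
  · exact add_nonneg (mul_nonneg ha ((hx' π o).1 φ)) (mul_nonneg hb ((hy' π o).1 φ))
  · simp only [Prod.snd_add, Prod.smul_snd, Pi.add_apply, Pi.smul_apply, smul_eq_mul,
      Finset.sum_add_distrib, ← Finset.mul_sum, (hx' π o).2, (hy' π o).2, Prod.fst_add,
      Prod.smul_fst]

theorem isCompact_jointStrategies : IsCompact (jointStrategies Pol O Φ) := by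
  have hbox : IsCompact (stdSimplex ℝ Pol ×ˢ Set.univ.pi fun _ : Pol => Set.univ.pi fun _ : O =>
      Set.univ.pi fun _ : Φ => Set.Icc (0 : ℝ) 1) :=
    (isCompact_stdSimplex ℝ Pol).prod <| isCompact_univ_pi fun _ => isCompact_univ_pi fun _ =>
      isCompact_univ_pi fun _ => isCompact_Icc
  refine hbox.of_isClosed_subset ?_ fun x hx => ⟨hx.1, fun π _ o _ φ _ => ⟨(hx.2 π o).1 φ, ?_⟩⟩
  · refine ((isClosed_stdSimplex ℝ Pol).preimage continuous_fst).and ?_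
    simp only [Set.ofPred_forall, Set.ofPred_and]
    exact isClosed_iInter fun π => isClosed_iInter fun o =>
      (isClosed_iInter fun φ => isClosed_le (by fun_prop) (by fun_prop)).inter
        (isClosed_eq (by fun_prop) (by fun_prop))
  · calc x.2 π o φ ≤ ∑ φ, x.2 π o φ :=
          Finset.single_le_sum (fun φ _ => (hx.2 π o).1 φ) (Finset.mem_univ φ)
      _ = x.1 π := (hx.2 π o).2
      _ ≤ 1 := (Finset.single_le_sum (fun π _ => hx.1.1 π) (Finset.mem_univ π)).trans_eq hx.1.2

end JointStrategies

theorem exists_forall_excess_nonpos [Finite Φ] {η c : ℝ} (hη : 0 < η) {𝓜 : Set (Model Pol O)}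
    (hc : DEC η 𝓜 ≤ c) {K : Φ → Set (Model Pol O)} (hK : ∀ φ, K φ ⊆ 𝓜)
    (hne : ∀ φ, (K φ).Nonempty) (hconv : ∀ φ, Convex ℝ (Model.coords '' K φ)) (star : Φ → Pol)
    (ρ : PMF Φ) :
    ∃ (p : PMF Pol) (q : Pol → O → PMF Φ), ∀ i : Test K ρ,
      i.excess η c star (jointStrategy p q) ≤ 0 := by
  classical
  have := Fintype.ofFinite Φ
  obtain ⟨φ₀, hφ₀⟩ := ρ.support_nonempty
  have : Nonempty Φ := ⟨φ₀⟩
  have : Nonempty (Test K ρ) := ⟨φ₀, hφ₀, _, (hne φ₀).some_mem, ∅, 1, fun _ _ => one_pos⟩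
  suffices hfan : ∀ (s : Finset (Test K ρ)), ∀ w ∈ stdSimplex ℝ s, ∀ ε > 0,
      ∃ x ∈ jointStrategies Pol O Φ, ∑ i : s, w i * i.1.excess η c star x < ε by
    obtain ⟨x, hx, hi⟩ := exists_forall_nonpos_of_forall_sum_lt isCompact_jointStrategies
      (fun i : Test K ρ => i.convexOn_excess η c star convex_jointStrategies)
      (fun i => (i.continuous_excess η c star).continuousOn) hfan
    obtain ⟨p, q, rfl⟩ := exists_jointStrategy_eq hx
    exact ⟨p, q, hi⟩
  intro s w hw ε hε
  have hcε : DEC η 𝓜 < (c + ε / 2 : ℝ) :=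
    hc.trans_lt (EReal.coe_lt_coe_iff.2 (lt_add_of_pos_right c (half_pos hε)))
  obtain ⟨p, q, hq, hle⟩ := exists_sum_mul_roundLoss_le hη hcε hK hne hconv star ρ
    (s.biUnion Test.obs) hw (fun i => i.1.prior_ne_zero) (fun i => i.1.model_mem)
  refine ⟨jointStrategy p q, jointStrategy_mem p q, ?_⟩
  have hexcess (i : s) : w i * i.1.excess η c star (jointStrategy p q) ≤
      w i * (roundLoss η (star i.1.param) (s.biUnion Test.obs) (fun π => (p π).toReal)
        (logLoss p q i.1.param) i.1.model.coords -
          (c + η⁻¹ * -Real.log (ρ i.1.param).toReal)) := by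
    by_cases hwi : w i = 0
    · simp [hwi]
    · exact mul_le_mul_of_nonneg_left (sub_le_sub_right (roundLoss_coords_mono hη _
        (Finset.subset_biUnion_of_mem _ i.2) _ (fun π o h =>
          tangentLoss_jointStrategy_le (i.1.scale_pos π o) (hq i hwi π o h))
        (logLoss_nonneg p q _)) _) (hw.1 i)
  refine (Finset.sum_le_sum fun i _ => hexcess i).trans_lt ?_
  simp only [mul_sub, mul_add, Finset.sum_sub_distrib, Finset.sum_add_distrib, ← Finset.sum_mul,
    hw.2, one_mul, mul_left_comm _ η⁻¹, ← Finset.mul_sum]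
  linarith

open Filter Topology in
theorem exists_strategy_forall_sum_mul_negLog_le [Finite Φ] {η c : ℝ} (hη : 0 < η)
    (hc : 0 ≤ c) {𝓜 : Set (Model Pol O)} (hDEC : DEC η 𝓜 ≤ c)
    {K : Φ → Set (Model Pol O)} (hK : ∀ φ, K φ ⊆ 𝓜)
    (hne : ∀ φ, (K φ).Nonempty) (hconv : ∀ φ, Convex ℝ (Model.coords '' K φ)) {star : Φ → Pol}
    (hV : ∀ φ, ∀ M ∈ K φ, ∀ π, M.value π ≤ 1 + M.value (star φ)) (ρ : PMF Φ) :
    ∃ (p : PMF Pol) (q : Pol → O → PMF Φ), ∀ φ, ∀ M ∈ K φ,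
      ∑ π, p π * (ENNReal.ofReal (1 + M.value (star φ) - M.value π)
          + ENNReal.ofReal η⁻¹ * ∑' o, M.law π o * negLog (q π o φ)) ≤
        ENNReal.ofReal (1 + c) + ENNReal.ofReal η⁻¹ * negLog (ρ φ) := by
  obtain ⟨p, q, hpq⟩ := exists_forall_excess_nonpos hη hDEC hK hne hconv star ρ
  refine ⟨p, q, fun φ M hM => ?_⟩
  by_cases hφ : ρ φ = 0
  · simp [hφ, negLog_zero, hη, ENNReal.mul_top]
  let loss (y : Pol → ℝ≥0∞) : ℝ≥0∞ :=
    ∑ π, p π * (ENNReal.ofReal (1 + M.value (star φ) - M.value π) + ENNReal.ofReal η⁻¹ * y π)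
  have hloss : Continuous loss := continuous_finsetSum _ fun π _ =>
    (ENNReal.continuous_const_mul (p.apply_ne_top π)).comp <| continuous_const.add <|
      (ENNReal.continuous_const_mul ENNReal.ofReal_ne_top).comp (continuous_apply π)
  have hfin (s : Finset O) : loss (fun π => ∑ o ∈ s, M.law π o * negLog (q π o φ)) ≤
      ENNReal.ofReal (1 + c) + ENNReal.ofReal η⁻¹ * negLog (ρ φ) := by
    -- A belief that vanishes has no tangent: cut it off at `δ` and let `δ → 0`.
    have hmax (π : Pol) (o : O) :
        Tendsto (fun δ => negLog (max (q π o φ) δ)) (𝓝[>] 0) (𝓝 (negLog (q π o φ))) :=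
      ((continuous_negLog.comp (continuous_const.max continuous_id)).tendsto' 0 _
        (by simp)).mono_left nhdsWithin_le_nhds
    have hsum : Tendsto (fun δ π => ∑ o ∈ s, M.law π o * negLog (max (q π o φ) δ)) (𝓝[>] 0)
        (𝓝 fun π => ∑ o ∈ s, M.law π o * negLog (q π o φ)) :=
      tendsto_pi_nhds.2 fun π => tendsto_finsetSum s fun o _ =>
        ENNReal.Tendsto.const_mul (hmax π o) (.inr ((M.law π).apply_ne_top o))
    refine le_of_tendsto ((hloss.tendsto _).comp hsum) ?_
    filter_upwards [Ioc_mem_nhdsGT (zero_lt_one (α := ℝ≥0∞))] with δ hδ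
    exact sum_mul_add_sum_negLog_le hη hc hpq hφ hM (hV φ M hM) s (fun _ _ => le_max_left _ _)
      (fun _ _ => (hδ.1.trans_le (le_max_right _ _)).ne')
      (fun π o => max_le ((q π o).coe_le_one φ) hδ.2)
  exact le_of_tendsto' ((hloss.tendsto _).comp
    (tendsto_pi_nhds.2 fun π => ENNReal.summable.hasSum)) hfin

end SingleRound

section DECBounds

variable {Pol O : Type*} [Fintype Pol]

theorem DEC_nonneg (η : ℝ) {𝓜 : Set (Model Pol O)} (hne : 𝓜.Nonempty) : 0 ≤ DEC η 𝓜 := by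
  obtain ⟨M, hM⟩ := hne
  have hco : M.law ∈ co 𝓜 :=
    ⟨PMF.pure M, by simp, by simpa using hM, fun π => by rw [PMF.pure_bind]⟩
  refine le_iSup₂_of_le M.law hco (le_iInf fun p => le_iSup₂_of_le M hM ?_)
  simp only [decObjective, kl_self, mul_zero, Finset.sum_const_zero, EReal.coe_ennreal_zero,
    sub_zero]
  exact EReal.coe_nonneg.2 (Finset.sum_nonneg fun π _ => mul_nonneg ENNReal.toReal_nonneg
    (sub_nonneg.2 (le_ciSup (Set.finite_range _).bddAbove _)))

theorem DEC_le_one [Nonempty Pol] (η : ℝ) {𝓜 : Set (Model Pol O)}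
    (hV : ∀ M ∈ 𝓜, ∀ π, M.value π ∈ Set.Icc (0 : ℝ) 1) : DEC η 𝓜 ≤ 1 := by
  refine iSup₂_le fun Mbar _ => iInf_le_of_le (PMF.pure (Classical.arbitrary Pol)) <|
    iSup₂_le fun M hM => (EReal.sub_le_sub le_rfl (EReal.coe_ennreal_nonneg _)).trans ?_
  rw [sub_zero, ← EReal.coe_one, EReal.coe_le_coe_iff]
  calc _ ≤ ∑ π, (PMF.pure (Classical.arbitrary Pol) π).toReal * 1 := by
        gcongr with π
        linarith [(hV M hM π).1, ciSup_le fun π' => (hV M hM π').2]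
    _ = 1 := by simpa using (toReal_mem_stdSimplex (PMF.pure (Classical.arbitrary Pol))).2

theorem exists_DEC_eq_coe [Nonempty Pol] (η : ℝ) {𝓜 : Set (Model Pol O)} (hne : 𝓜.Nonempty)
    (hV : ∀ M ∈ 𝓜, ∀ π, M.value π ∈ Set.Icc (0 : ℝ) 1) : ∃ c : ℝ, 0 ≤ c ∧ DEC η 𝓜 = c := by
  have h0 : 0 ≤ DEC η 𝓜 := DEC_nonneg η hne
  have h1 : DEC η 𝓜 ≤ 1 := DEC_le_one η hV
  exact ⟨(DEC η 𝓜).toReal, EReal.toReal_nonneg h0, (EReal.coe_toReal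
    (h1.trans_lt (EReal.coe_lt_top 1)).ne ((EReal.bot_lt_coe 0).trans_le h0).ne').symm⟩

end DECBounds

/-! ### Values and mixtures of Markov decision processes -/

section MDP

variable {S A F : Type*}

theorem cumReward_nonneg {R : Reward S A F} (hR : ∀ s a, 0 ≤ R.mean s a) (τ : Traj S A) :
    0 ≤ cumReward R τ :=
  List.sum_nonneg fun r hr => by
    obtain ⟨x, _, rfl⟩ := List.mem_map.1 hr
    exact hR _ _

theorem cumReward_mix {R R' R'' : Reward S A F} {a b : ℝ}
    (h : ∀ s x, R''.mean s x = a * R.mean s x + b * R'.mean s x) (τ : Traj S A) :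
    cumReward R'' τ = a * cumReward R τ + b * cumReward R' τ := by
  simp only [cumReward, h, List.sum_map_add, List.sum_map_mul_left]

variable {H : ℕ} {s₁ : S} {Pol : Finset (Policy S A)} {P : Transition S A}

theorem toReal_trajLaw_mul_cumReward_le {R : Reward S A F} {π : Policy S A}
    (hτ : ∀ τ ∈ (trajLaw P π H s₁).support, cumReward R τ ≤ 1) (τ : Traj S A) :
    (trajLaw P π H s₁ τ).toReal * cumReward R τ ≤ (trajLaw P π H s₁ τ).toReal := by
  by_cases h0 : trajLaw P π H s₁ τ = 0
  · simp [h0]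
  · exact mul_le_of_le_one_right ENNReal.toReal_nonneg (hτ τ ((PMF.mem_support_iff _ _).2 h0))

theorem summable_toReal_trajLaw_mul_cumReward {R : Reward S A F} (hR : ∀ s a, 0 ≤ R.mean s a)
    {π : Policy S A} (hτ : ∀ τ ∈ (trajLaw P π H s₁).support, cumReward R τ ≤ 1) :
    Summable fun τ => (trajLaw P π H s₁ τ).toReal * cumReward R τ :=
  Summable.of_nonneg_of_le
    (fun τ => mul_nonneg ENNReal.toReal_nonneg (cumReward_nonneg hR τ))
    (toReal_trajLaw_mul_cumReward_le hτ) (hasSum_toReal _).summable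

theorem mdp_value_mem_Icc {R : Reward S A F} (hR : ∀ s a, 0 ≤ R.mean s a) (π : Pol)
    (hτ : ∀ τ ∈ (trajLaw P π.1 H s₁).support, cumReward R τ ≤ 1) :
    (mdp H s₁ Pol P R).value π ∈ Set.Icc (0 : ℝ) 1 :=
  ⟨tsum_nonneg fun τ => mul_nonneg ENNReal.toReal_nonneg (cumReward_nonneg hR τ),
    hasSum_le (toReal_trajLaw_mul_cumReward_le hτ)
      (summable_toReal_trajLaw_mul_cumReward hR hτ).hasSum (hasSum_toReal _)⟩

theorem mdp_law_apply (R : Reward S A F) (π : Pol) (o : Obs S A F) :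
    (mdp H s₁ Pol P R).law π o = trajLaw P π.1 H s₁ o.1 * R.feedback o.1 o.2 := by
  classical
  obtain ⟨τ, f⟩ := o
  simp only [mdp, PMF.bind_apply, PMF.map_apply]
  rw [tsum_eq_single τ, tsum_eq_single f]
  · simp
  · intro f' hf'
    simp [hf'.symm]
  · intro τ' hτ'
    simp [hτ'.symm]

theorem convex_coords_mdp {𝓡 : Set (Reward S A F)} (h_conv : ConvexRewards 𝓡)
    (hR : ∀ R ∈ 𝓡, ∀ s a, 0 ≤ R.mean s a)
    (hτ : ∀ R ∈ 𝓡, ∀ π ∈ Pol, ∀ τ ∈ (trajLaw P π H s₁).support, cumReward R τ ≤ 1) :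
    Convex ℝ (Model.coords '' (mdp H s₁ Pol P '' 𝓡)) := by
  rintro _ ⟨_, ⟨R, hR𝓡, rfl⟩, rfl⟩ _ ⟨_, ⟨R', hR'𝓡, rfl⟩, rfl⟩ a b ha hb hab
  lift a to ℝ≥0 using ha
  lift b to ℝ≥0 using hb
  obtain ⟨R'', hR'', hmean, hfeedback⟩ := h_conv R hR𝓡 R' hR'𝓡 a b (by exact_mod_cast hab)
  refine ⟨_, ⟨R'', hR'', rfl⟩, Prod.ext ?_ ?_⟩
  · funext π o
    have ne_top (c : ℝ≥0) (Q : Reward S A F) : (c : ℝ≥0∞) * Q.feedback o.1 o.2 ≠ ∞ :=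
      ENNReal.mul_ne_top ENNReal.coe_ne_top (PMF.apply_ne_top _ _)
    simp only [Model.coords, mdp_law_apply, hfeedback, ENNReal.toReal_mul,
      ENNReal.toReal_add (ne_top _ _) (ne_top _ _), ENNReal.coe_toReal, Prod.fst_add,
      Prod.smul_fst, Pi.add_apply, Pi.smul_apply, smul_eq_mul]
    ring
  · funext π
    have hs := summable_toReal_trajLaw_mul_cumReward (hR R hR𝓡) (hτ R hR𝓡 π.1 π.2)
    have hs' := summable_toReal_trajLaw_mul_cumReward (hR R' hR'𝓡) (hτ R' hR'𝓡 π.1 π.2)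
    simp only [Model.coords, mdp, cumReward_mix hmean, Prod.snd_add, Prod.smul_snd, Pi.add_apply,
      Pi.smul_apply, smul_eq_mul, mul_add, mul_left_comm (trajLaw _ _ _ _ _).toReal]
    rw [(hs.mul_left _).tsum_add (hs'.mul_left _), tsum_mul_left, tsum_mul_left]

end MDP

/-! ### The interaction over many rounds -/

section Expectation

variable {α β : Type*}

theorem tsum_bind_mul (p : PMF α) (q : α → PMF β) (g : β → ℝ≥0∞) :
    ∑' b, (p.bind q) b * g b = ∑' a, p a * ∑' b, q a b * g b := by
  simp only [PMF.bind_apply, ← ENNReal.tsum_mul_right, ← ENNReal.tsum_mul_left]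
  rw [ENNReal.tsum_comm]
  simp only [mul_assoc]

theorem tsum_map_mul (p : PMF α) (f : α → β) (g : β → ℝ≥0∞) :
    ∑' b, (p.map f) b * g b = ∑' a, p a * g (f a) := by
  rw [← PMF.bind_pure_comp, tsum_bind_mul]
  simp

theorem tsum_mul_const_add (p : PMF α) (C : ℝ≥0∞) (g : α → ℝ≥0∞) :
    ∑' a, p a * (C + g a) = C + ∑' a, p a * g a := by
  simp only [mul_add, ENNReal.tsum_add, ENNReal.tsum_mul_right, p.tsum_coe, one_mul]

theorem tsum_mul_le_of_forall_le (p : PMF α) {g : α → ℝ≥0∞} {C : ℝ≥0∞} (h : ∀ a, g a ≤ C) :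
    ∑' a, p a * g a ≤ C :=
  calc ∑' a, p a * g a ≤ ∑' a, p a * C := ENNReal.tsum_le_tsum fun a => mul_le_mul_right (h a) _
    _ = C := by rw [ENNReal.tsum_mul_right, p.tsum_coe, one_mul]

theorem tsum_toReal_mul_le {p : PMF α} {f : α → ℝ} {B C : ℝ} (hf : ∀ a ∈ p.support, |f a| ≤ B)
    (hBC : 0 ≤ B + C) (h : ∑' a, p a * ENNReal.ofReal (B + f a) ≤ ENNReal.ofReal (B + C)) :
    ∑' a, (p a).toReal * f a ≤ C := by
  have hbound (a : α) : |(p a).toReal * f a| ≤ (p a).toReal * B := by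
    by_cases ha : p a = 0
    · simp [ha]
    · rw [abs_mul, ENNReal.abs_toReal]
      exact mul_le_mul_of_nonneg_left (hf a ((p.mem_support_iff a).2 ha)) ENNReal.toReal_nonneg
  have hB : HasSum (fun a => (p a).toReal * B) B := by simpa using (hasSum_toReal p).mul_right B
  have hsum : Summable fun a => (p a).toReal * f a := .of_norm_bounded hB.summable hbound
  have hnonneg (a : α) : 0 ≤ (p a).toReal * (B + f a) := by
    rw [mul_add]
    linarith [neg_le_of_abs_le (hbound a)]
  have hadd : HasSum (fun a => (p a).toReal * (B + f a)) (B + ∑' a, (p a).toReal * f a) := by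
    simpa only [mul_add] using hB.add hsum.hasSum
  have hofReal : ∑' a, p a * ENNReal.ofReal (B + f a) =
      ENNReal.ofReal (B + ∑' a, (p a).toReal * f a) := by
    rw [← hadd.tsum_eq, ENNReal.ofReal_tsum_of_nonneg hnonneg hadd.summable]
    simp only [ENNReal.ofReal_mul ENNReal.toReal_nonneg, ENNReal.ofReal_toReal (p.apply_ne_top _)]
  rw [hofReal, ENNReal.ofReal_le_ofReal_iff hBC] at h
  linarith

end Expectation

section Interaction

variable {S A F : Type*} {H : ℕ} {s₁ : S} {Pol : Finset (Policy S A)} {𝓡 : Set (Reward S A F)}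
  {P : Transition S A} {alg : Algorithm F Pol} {πstar : Pol}

theorem tsum_historyLaw_mul_le (adv : Adversary Pol 𝓡) {V : List (Round Pol 𝓡) → ℝ≥0∞} {C : ℝ≥0∞}
    (hV : ∀ h R, ∑' π, alg (h.map fun x => x.2) π *
      ∑' o, (mdp H s₁ Pol P R.1).law π o * V (h ++ [(R, π, o)]) ≤ C + V h) (t : ℕ) :
    ∑' h, historyLaw H s₁ P alg adv t h * V h ≤ t * C + V [] := by
  induction t with
  | zero => simp [historyLaw]
  | succ t ih =>
    simp only [historyLaw, tsum_bind_mul, tsum_map_mul]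
    calc _ ≤ ∑' h, historyLaw H s₁ P alg adv t h * (C + V h) :=
          ENNReal.tsum_le_tsum fun h => mul_le_mul_right
            (tsum_mul_le_of_forall_le _ fun R => hV h R) _
      _ ≤ C + (t * C + V []) := by
          rw [tsum_mul_const_add]
          exact add_le_add_right ih _
      _ = (t + 1 : ℕ) * C + V [] := by
          push_cast
          ring

theorem length_of_mem_support_historyLaw (adv : Adversary Pol 𝓡) (t : ℕ) :
    ∀ h ∈ (historyLaw H s₁ P alg adv t).support, h.length = t := by
  induction t with
  | zero => simp [historyLaw]
  | succ t ih =>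
    intro h hh
    simp only [historyLaw, PMF.mem_support_bind_iff, PMF.mem_support_map_iff] at hh
    obtain ⟨h', hh', R, _, π, _, o, _, rfl⟩ := hh
    simp [ih h' hh']

theorem regret_append_singleton (h : List (Round Pol 𝓡)) (x : Round Pol 𝓡) :
    regret H s₁ P πstar (h ++ [x]) = regret H s₁ P πstar h +
      ((mdp H s₁ Pol P x.1.1).value πstar - (mdp H s₁ Pol P x.1.1).value x.2.1) := by
  simp [regret]

theorem abs_regret_le_length
    (hV : ∀ R ∈ 𝓡, ∀ π, (mdp H s₁ Pol P R).value π ∈ Set.Icc (0 : ℝ) 1)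
    (h : List (Round Pol 𝓡)) : |regret H s₁ P πstar h| ≤ h.length := by
  induction h using List.reverseRecOn with
  | nil => simp [regret]
  | append_singleton h x ih =>
    have hx := abs_sub_le_of_le_of_le (hV x.1.1 x.1.2 πstar).1 (hV x.1.1 x.1.2 πstar).2
      (hV x.1.1 x.1.2 x.2.1).1 (hV x.1.1 x.1.2 x.2.1).2
    rw [regret_append_singleton, List.length_append, List.length_singleton, Nat.cast_add_one]
    exact (abs_add_le _ _).trans (add_le_add ih (by simpa using hx))

theorem ofReal_length_add_regret_append_singleton
    (hV : ∀ R ∈ 𝓡, ∀ π, (mdp H s₁ Pol P R).value π ∈ Set.Icc (0 : ℝ) 1)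
    (h : List (Round Pol 𝓡)) (x : Round Pol 𝓡) :
    ENNReal.ofReal ((h ++ [x]).length + regret H s₁ P πstar (h ++ [x])) =
      ENNReal.ofReal (h.length + regret H s₁ P πstar h) + ENNReal.ofReal
        (1 + (mdp H s₁ Pol P x.1.1).value πstar - (mdp H s₁ Pol P x.1.1).value x.2.1) := by
  have hregret := neg_le_of_abs_le (abs_regret_le_length (πstar := πstar) hV h)
  have hstar := (hV x.1.1 x.1.2 πstar).1
  have hx := (hV x.1.1 x.1.2 x.2.1).2
  rw [← ENNReal.ofReal_add (by linarith) (by linarith), regret_append_singleton,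
    List.length_append, List.length_singleton, Nat.cast_add_one]
  congr 1
  ring

theorem expectedRegret_le (hV : ∀ R ∈ 𝓡, ∀ π, (mdp H s₁ Pol P R).value π ∈ Set.Icc (0 : ℝ) 1)
    {L : List (Pol × Obs S A F) → ℝ≥0∞} {b c : ℝ} (hb : 0 ≤ b) (hc : 0 ≤ c)
    (hL : ∀ l, ∀ R ∈ 𝓡, ∑ π, alg l π *
        (ENNReal.ofReal (1 + (mdp H s₁ Pol P R).value πstar - (mdp H s₁ Pol P R).value π)
          + ∑' o, (mdp H s₁ Pol P R).law π o * L (l ++ [(π, o)])) ≤ ENNReal.ofReal (1 + c) + L l)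
    (hL₀ : L [] ≤ ENNReal.ofReal b) (adv : Adversary Pol 𝓡) (T : ℕ) :
    expectedRegret H s₁ P alg adv πstar T ≤ b + T * c := by
  let V (h : List (Round Pol 𝓡)) : ℝ≥0∞ :=
    ENNReal.ofReal (h.length + regret H s₁ P πstar h) + L (h.map fun x => x.2)
  have hround (h : List (Round Pol 𝓡)) (R : 𝓡) : ∑' π, alg (h.map fun x => x.2) π *
      ∑' o, (mdp H s₁ Pol P R.1).law π o * V (h ++ [(R, π, o)]) ≤ ENNReal.ofReal (1 + c) + V h := by
    simp only [V, ofReal_length_add_regret_append_singleton hV, List.map_append, List.map_cons,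
      List.map_nil, add_assoc, tsum_mul_const_add]
    rw [tsum_fintype, add_left_comm]
    exact add_le_add_right (hL _ R.1 R.2) _
  refine tsum_toReal_mul_le (fun h hh => ?_) ?_ ?_ (B := T)
  · rw [← length_of_mem_support_historyLaw adv T h hh]
    exact abs_regret_le_length hV h
  · positivity
  calc ∑' h, historyLaw H s₁ P alg adv T h * ENNReal.ofReal (T + regret H s₁ P πstar h)
      ≤ ∑' h, historyLaw H s₁ P alg adv T h * V h := by
        refine ENNReal.tsum_le_tsum fun h => ?_
        by_cases hh : historyLaw H s₁ P alg adv T h = 0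
        · simp [hh]
        · rw [← length_of_mem_support_historyLaw adv T h ((PMF.mem_support_iff _ _).2 hh)]
          exact mul_le_mul_right le_self_add _
    _ ≤ T * ENNReal.ofReal (1 + c) + V [] := tsum_historyLaw_mul_le adv hround T
    _ ≤ T * ENNReal.ofReal (1 + c) + ENNReal.ofReal b :=
        add_le_add le_rfl (by simpa [V, regret] using hL₀)
    _ = ENNReal.ofReal (T + (b + T * c)) := by
        rw [← ENNReal.ofReal_natCast, ← ENNReal.ofReal_mul T.cast_nonneg,
          ← ENNReal.ofReal_add (by positivity) hb]
        congr 1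
        ring

theorem negLog_uniformOfFintype {Φ : Type*} [Fintype Φ] [Nonempty Φ] (φ : Φ) :
    negLog (PMF.uniformOfFintype Φ φ) = ENNReal.ofReal (Real.log (Fintype.card Φ)) := by
  rw [negLog_of_ne_zero (by simp) (PMF.apply_ne_top _ _)]
  simp [Real.log_inv]

theorem exists_algorithm_forall_expectedRegret_le {η c : ℝ} [Nonempty Pol]
    {𝓟 : Finset (Transition S A)} (hη : 0 < η) (hc : 0 ≤ c)
    (hDEC : DEC η (mdpClass H s₁ Pol 𝓟 𝓡) ≤ c)
    (h𝓟 : 𝓟.Nonempty) (h𝓡 : 𝓡.Nonempty) (h_conv : ConvexRewards 𝓡)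
    (h_nonneg : ∀ R ∈ 𝓡, ∀ s a, 0 ≤ R.mean s a)
    (h_total : ∀ P ∈ 𝓟, ∀ R ∈ 𝓡, ∀ π ∈ Pol, ∀ τ ∈ (trajLaw P π H s₁).support,
      cumReward R τ ≤ 1) :
    ∃ alg : Algorithm F Pol, ∀ P ∈ 𝓟, ∀ (πstar : Pol) (adv : Adversary Pol 𝓡) (T : ℕ),
      expectedRegret H s₁ P alg adv πstar T ≤ Real.log (Pol.card * 𝓟.card) / η + T * c := by
  have : Nonempty 𝓟 := h𝓟.to_subtype
  have hV (P : 𝓟) (R) (hR : R ∈ 𝓡) (π : Pol) := mdp_value_mem_Icc (h_nonneg R hR) π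
    (h_total P.1 P.2 R hR π.1 π.2)
  choose p q hpq using exists_strategy_forall_sum_mul_negLog_le (Φ := Pol × 𝓟) (star := Prod.fst)
    (K := fun φ => mdp H s₁ Pol φ.2.1 '' 𝓡) hη hc hDEC
    (fun φ => Set.image_subset_iff.2 fun R hR => ⟨φ.2.1, φ.2.2, R, hR, rfl⟩)
    (fun φ => h𝓡.image _)
    (fun φ => convex_coords_mdp h_conv h_nonneg (h_total φ.2.1 φ.2.2))
    (by
      rintro φ _ ⟨R, hR, rfl⟩ π
      linarith [(hV φ.2 R hR π).2, (hV φ.2 R hR φ.1).1])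
  let belief (l : List (Pol × Obs S A F)) : PMF (Pol × 𝓟) :=
    l.foldl (fun ρ x => q ρ x.1 x.2) (PMF.uniformOfFintype _)
  refine ⟨fun l => p (belief l), fun P hP πstar adv T => expectedRegret_le (hV ⟨P, hP⟩)
    (L := fun l => ENNReal.ofReal η⁻¹ * negLog (belief l (πstar, ⟨P, hP⟩)))
    (div_nonneg (by exact_mod_cast Real.log_natCast_nonneg _) hη.le) hc (fun l R hR => ?_) ?_ adv T⟩
  · simpa only [belief, List.foldl_append, List.foldl_cons, List.foldl_nil, mul_left_comm _
      (ENNReal.ofReal η⁻¹), ENNReal.tsum_mul_left] using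
      hpq (belief l) (πstar, ⟨P, hP⟩) _ ⟨R, hR, rfl⟩
  · simp only [belief, List.foldl_nil, negLog_uniformOfFintype]
    rw [← ENNReal.ofReal_mul (by positivity), div_eq_inv_mul]
    simp

end Interaction

end HybridDEC

end

open HybridDEC in
theorem mainTheorem6 {S A F : Type*} (H : ℕ) (s₁ : S)
    (Pol : Finset (HybridDEC.Policy S A)) (hPol : Pol.Nonempty)
    (𝓟 : Finset (HybridDEC.Transition S A))
    (𝓡 : Set (HybridDEC.Reward S A F))
    (h_conv : HybridDEC.ConvexRewards 𝓡)
    (h_range : ∀ R ∈ 𝓡, ∀ s a, R.mean s a ∈ Set.Icc (0 : ℝ) 1)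
    (h_total : ∀ P ∈ 𝓟, ∀ R ∈ 𝓡, ∀ π ∈ Pol, ∀ τ ∈ (HybridDEC.trajLaw P π H s₁).support,
      HybridDEC.cumReward R τ ≤ 1)
    (T : ℕ) (η : ℝ) (hη : 0 < η) :
    ∃ alg : HybridDEC.Algorithm F Pol,
      ∀ P ∈ 𝓟, ∀ (πstar : Pol) (adv : HybridDEC.Adversary Pol 𝓡),
        ((HybridDEC.expectedRegret H s₁ P alg adv πstar T : ℝ) : EReal) ≤
          ((Real.log (Pol.card * 𝓟.card) / η : ℝ) : EReal)
            + ((T : ℝ) : EReal) * HybridDEC.DEC η (HybridDEC.mdpClass H s₁ Pol 𝓟 𝓡) := by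
  have : Nonempty Pol := hPol.to_subtype
  rcases 𝓡.eq_empty_or_nonempty with rfl | h𝓡
  · exact ⟨fun _ => PMF.pure (Classical.arbitrary Pol), fun P _ πstar adv =>
      ((adv []).support_nonempty.some.2).elim⟩
  rcases 𝓟.eq_empty_or_nonempty with rfl | h𝓟
  · exact ⟨fun _ => PMF.pure (Classical.arbitrary Pol), by simp⟩
  obtain ⟨c, hc, hDEC⟩ := exists_DEC_eq_coe η (𝓜 := mdpClass H s₁ Pol 𝓟 𝓡)
    ⟨_, h𝓟.choose, h𝓟.choose_spec, h𝓡.some, h𝓡.some_mem, rfl⟩ (by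
      rintro _ ⟨P, hP, R, hR, rfl⟩ π
      exact mdp_value_mem_Icc (fun s a => (h_range R hR s a).1) π (h_total P hP R hR π.1 π.2))
  obtain ⟨alg, h_alg⟩ := exists_algorithm_forall_expectedRegret_le hη hc hDEC.le h𝓟 h𝓡 h_conv
    (fun R hR s a => (h_range R hR s a).1) h_total
  refine ⟨alg, fun P hP πstar adv => ?_⟩
  rw [hDEC, ← EReal.coe_mul, ← EReal.coe_add, EReal.coe_le_coe_iff]
  exact h_alg P hP πstar adv T
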